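/- **Theorem 2.2.** Notation. Let $\mathbb D=\{z\in\mathbb C:|z|<1\}$ and $\ell^2=\ell^2(\{0,1,2,\dots\})$ (complex sequences), let $\delta_n\in\ell^2$ be the unit vector with coefficient $1$ in place $n$ and $0$ elsewhere, and for $|\alpha|\le 1$ put $\rho(\alpha)=(1-|\alpha|^2)^{1/2}$ and $\Theta(\alpha)=\begin{pmatrix}\bar\alpha&\rho(\alpha)\\ \rho(\alpha)&-\alpha\end{pmatrix}$. For $\alpha=\{\alpha_n\}_{n\ge0}$ with all $|\alpha_n|<1$, the *proper CMV matrix* with parameters $\alpha$ is the semi-infinite matrix $\mathcal C(\alpha)=\mathcal L\mathcal M$, where $\mathcal L=\Theta(\alpha_0)\oplus\Theta(\alpha_2)\oplus\Theta(\alpha_4)\oplus\cdots$ and $\mathcal M=\mathbf 1_{1\times1}\oplus\Theta(\alpha_1)\oplus\Theta(\alpha_3)\oplus\cdots$. A *cyclic unitary model* $(\mathcal H,U,v_0)$ is a unitary operator $U$ on a complex Hilbert space $\mathcal H$ together with a unit vector $v_0\in\mathcal H$ that is cyclic, i.e. the finite linear combinations of $\{U^nv_0\}_{n\in\mathbb Z}$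 are dense in $\mathcal H$; it is *proper* if $\dim\mathcal H=\infty$. Two models $(\mathcal H,U,v_0)$ and $(\widetilde{\mathcal H},\widetilde U,\tilde v_0)$ are *equivalent* if there is a unitary $W$ from $\mathcal H$ onto $\widetilde{\mathcal H}$ with $Wv_0=\tilde v_0$ and $WUW^{-1}=\widetilde U$. A probability measure $\mu$ on $\partial\mathbb D$ is *nontrivial* if it is not supported on a finite set; its orthonormal polynomials $\varphi_n$ are determined by $\varphi_n(z)=\kappa_nz^n+\text{lower order}$ with $\kappa_n>0$, $\varphi_n\perp\{1,z,\dots,z^{n-1}\}$ and $\|\varphi_n\|=1$ in $L^2(\partial\mathbb D,d\mu)$, and its *Verblunsky coefficients* are the $\alpha_n\in\mathbb D$, $n\ge 0$, with $$\rho(\alpha_n)\,\varphi_{n+1}(z)=z\varphi_n(z)-\bar\alpha_n\varphi_n^*(z),\qquad \varphi_n^*(z)=z^n\,\overline{\varphi_n(1/\bar z)}.$$ (a) Every proper CMV matrix is the matrix, with respect to $\{\delta_n\}_{n\ge0}$, of exactly one unitary operator $\mathcal C$ on $\ell^2$, and $\delta_0$ is cyclic for $\mathcal C$; thus $(\ell^2,\mathcal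 C,\delta_0)$ is a proper cyclic unitary model. (b) For every proper cyclic unitary model $(\mathcal H,U,v_0)$ there is exactly one proper CMV matrix $\mathcal C$ such that $(\ell^2,\mathcal C,\delta_0)$ is equivalent to $(\mathcal H,U,v_0)$. (c) (Verblunsky's theorem) Every sequence $\{\alpha_n\}_{n\ge0}\in\mathbb D^\infty$ is the sequence of Verblunsky coefficients of some nontrivial probability measure on $\partial\mathbb D$. -/

import Mathlib

open scoped ComplexConjugate

namespace CMV

/-! ### Cyclic unitary models -/

/-- A cyclic unitary model `(H, U, v₀)`: a unitary operator `U` on `H` with a unit vector `v₀`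
such that the finite linear combinations of the `U ^ n v₀`, `n ∈ ℤ`, are dense in `H`. -/
structure IsCyclicUnitaryModel {H : Type*} [NormedAddCommGroup H] [InnerProductSpace ℂ H]
    (U : H ≃ₗᵢ[ℂ] H) (v₀ : H) : Prop where
  norm_eq_one : ‖v₀‖ = 1
  cyclic : Dense (Submodule.span ℂ (Set.range fun n : ℤ => (U ^ n) v₀) : Set H)

/-- A cyclic unitary model is proper if the space is infinite-dimensional. -/
structure IsProperCyclicUnitaryModel {H : Type*} [NormedAddCommGroup H] [InnerProductSpace ℂ H]
    (U : H ≃ₗᵢ[ℂ] H) (v₀ : H) : Prop extends IsCyclicUnitaryModel U v₀ where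
  infinite_dimensional : ¬ FiniteDimensional ℂ H

/-- Equivalence of `(H, U, v₀)` and `(H', U', v₀')`: there is a unitary `W` from `H` onto `H'`
with `W v₀ = v₀'` and `W U W⁻¹ = U'`. -/
def ModelEquiv {H H' : Type*} [NormedAddCommGroup H] [InnerProductSpace ℂ H]
    [NormedAddCommGroup H'] [InnerProductSpace ℂ H']
    (U : H ≃ₗᵢ[ℂ] H) (v₀ : H) (U' : H' ≃ₗᵢ[ℂ] H') (v₀' : H') : Prop :=
  ∃ W : H ≃ₗᵢ[ℂ] H', W v₀ = v₀' ∧ ∀ y : H', W (U (W.symm y)) = U' y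

/-! ### CMV matrices -/

/-- `ρ = (1 - |α|²)^{1/2}`. -/
noncomputable def rho (a : ℂ) : ℝ := Real.sqrt (1 - ‖a‖ ^ 2)

/-- The `2 × 2` block `Θ(α)`. -/
noncomputable def theta (a : ℂ) : Matrix (Fin 2) (Fin 2) ℂ :=
  !![conj a, (rho a : ℂ); (rho a : ℂ), -a]

/-- The semi-infinite block diagonal matrix `B₀ ⊕ B₁ ⊕ B₂ ⊕ ⋯` with `2 × 2` blocks. -/
def directSum (B : ℕ → Matrix (Fin 2) (Fin 2) ℂ) : Matrix ℕ ℕ ℂ := fun m k =>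
  if m / 2 = k / 2 then B (m / 2) (Fin.ofNat 2 m) (Fin.ofNat 2 k) else 0

/-- The matrix `1 ⊕ A` with a `1 × 1` block in front of `A`. -/
def oneDirectSum (A : Matrix ℕ ℕ ℂ) : Matrix ℕ ℕ ℂ
  | 0, 0 => 1
  | 0, _ + 1 => 0
  | _ + 1, 0 => 0
  | m + 1, k + 1 => A m k

/-- `ℒ = Θ(α₀) ⊕ Θ(α₂) ⊕ Θ(α₄) ⊕ ⋯`. -/
noncomputable def matL (α : ℕ → ℂ) : Matrix ℕ ℕ ℂ :=
  directSum fun j => theta (α (2 * j))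

/-- `ℳ = 1 ⊕ Θ(α₁) ⊕ Θ(α₃) ⊕ ⋯`. -/
noncomputable def matM (α : ℕ → ℂ) : Matrix ℕ ℕ ℂ :=
  oneDirectSum (directSum fun j => theta (α (2 * j + 1)))

/-- The entries of the matrix product `𝒞 = ℒ ℳ`. The sum over all `j` is finite, since
`ℒ m j = 0` for `j ≥ m + 2` (`matL_eq_zero`). -/
noncomputable def matC (α : ℕ → ℂ) : Matrix ℕ ℕ ℂ := fun m k =>
  ∑ j ∈ Finset.range (m + 2), matL α m j * matM α j k

theorem matL_eq_zero (α : ℕ → ℂ) {m j : ℕ} (h : m + 2 ≤ j) : matL α m j = 0 := by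
  have h' : m / 2 ≠ j / 2 := by omega
  simp [matL, directSum, h']

/-- The Hilbert space `ℓ² = ℓ²({0, 1, 2, …})` of complex sequences. -/
abbrev ell2 : Type := lp (fun _ : ℕ => ℂ) 2

/-- The unit vector `δₙ` of `ℓ²`, with coefficient `1` in place `n` and `0` elsewhere. -/
noncomputable def delta (n : ℕ) : ell2 := lp.single 2 n 1

/-- `C` is the operator on `ℓ²` with matrix `A`: the coefficient of `C δₖ` in place `m` is
`A m k`. -/
def HasMatrix (C : ell2 ≃ₗᵢ[ℂ] ell2) (A : Matrix ℕ ℕ ℂ) : Prop :=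
  ∀ m k : ℕ, C (delta k) m = A m k

/-- The unitary operators on `ℓ²` that are given by proper CMV matrices (all `|αₙ| < 1`). -/
def IsProperCMV (C : ell2 ≃ₗᵢ[ℂ] ell2) : Prop :=
  ∃ α : ℕ → ℂ, (∀ n, ‖α n‖ < 1) ∧ HasMatrix C (matC α)

/-! ### Verblunsky coefficients of measures on the unit circle -/

open MeasureTheory

/-- The unit circle carries its Borel σ-algebra. -/
noncomputable instance instMeasurableSpaceCircle : MeasurableSpace Circle := borel Circle

instance instBorelSpaceCircle : BorelSpace Circle := ⟨rfl⟩

/-- A measure on the unit circle is nontrivial if it is not supported on a finite set. -/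
def IsNontrivialMeasure (μ : Measure Circle) : Prop :=
  ∀ s : Set Circle, s.Finite → μ sᶜ ≠ 0

/-- `φ` is the sequence of orthonormal polynomials of `μ`: `φₙ = κₙ zⁿ + lower order` with
`κₙ > 0`, `φₙ ⊥ {1, z, …, zⁿ⁻¹}` and `‖φₙ‖ = 1` in `L²(μ)`. -/
structure IsOrthonormalPolynomials (μ : Measure Circle) (φ : ℕ → Polynomial ℂ) : Prop where
  natDegree_eq : ∀ n, (φ n).natDegree = n
  leadingCoeff_pos : ∀ n, ∃ κ : ℝ, 0 < κ ∧ (φ n).leadingCoeff = (κ : ℂ)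
  orthogonal : ∀ n j, j < n → ∫ z : Circle, conj ((z : ℂ) ^ j) * (φ n).eval (z : ℂ) ∂μ = 0
  normalized : ∀ n, ∫ z : Circle, ‖(φ n).eval (z : ℂ)‖ ^ 2 ∂μ = 1

/-- The Szegő dual `Pₙ*(z) = ∑_{j ≤ n} conj(c_{n-j}) zʲ` of `Pₙ(z) = ∑_{j ≤ n} cⱼ zʲ`. -/
noncomputable def szegoDual (n : ℕ) (P : Polynomial ℂ) : Polynomial ℂ :=
  ∑ j ∈ Finset.range (n + 1), Polynomial.monomial j (conj (P.coeff (n - j)))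

/-- `α` is the sequence of Verblunsky coefficients of `μ`: `αₙ ∈ 𝔻`, and the orthonormal
polynomials of `μ` satisfy the Szegő recursion `ρₙ φₙ₊₁ = z φₙ - conj(αₙ) φₙ*`. -/
def IsVerblunskyCoefficients (μ : Measure Circle) (α : ℕ → ℂ) : Prop :=
  (∀ n, ‖α n‖ < 1) ∧ ∃ φ : ℕ → Polynomial ℂ, IsOrthonormalPolynomials μ φ ∧
    ∀ n, Polynomial.C (rho (α n) : ℂ) * φ (n + 1) =
      Polynomial.X * φ n - Polynomial.C (conj (α n)) * szegoDual n (φ n)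

end CMV

/-!
In a model `(H, U, v)` run the Szegő recursion for vectors `φₙ`, `φₙ*`, starting from
`φ₀ = φ₀* = v` and with coefficients `αₙ = ⟪U φₙ, φₙ*⟫`. In a proper model `|αₙ| < 1`, and then
`φₙ ⟂ v, …, Uⁿ⁻¹ v` and `φₙ* ⟂ U v, …, Uⁿ v`, so the vectors `φ₀*, φ₁, U⁻¹ φ₂*, U⁻¹ φ₃, …` are
the orthonormalization of `v, U v, U⁻¹ v, U² v, …`. Between this basis `χ` and its companion
`x = (φ₀, U⁻¹ φ₁*, U⁻¹ φ₂, …)`, the even steps of the recursion are exactly the relation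
`U x = χ ℒ` and the odd steps the relation `χ = x ℳ`; hence `U` has the matrix `ℒ ℳ` in the basis
`χ`. Conversely these relations exhibit `ᾱₙ` as a diagonal entry of `ℒ` or `ℳ`, so a proper CMV
matrix is recovered from the equivalence class of its model. Verblunsky's theorem follows by
taking the spectral measure of `δ₀` for `𝒞(α)`, whose orthonormal polynomials obey the same
recursion.
-/

namespace CMV

open Finset
open scoped Matrix

/-! ### Tridiagonal and block diagonal matrices -/

theorem rho_mul_self {a : ℂ} (ha : ‖a‖ ≤ 1) : (rho a : ℂ) * rho a = 1 - a * conj a := by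
  rw [← Complex.ofReal_mul, rho, Real.mul_self_sqrt (by nlinarith [norm_nonneg a]),
    Complex.mul_conj, Complex.normSq_eq_norm_sq]
  push_cast
  rfl

theorem rho_pos {a : ℂ} (ha : ‖a‖ < 1) : 0 < rho a :=
  Real.sqrt_pos.2 (by nlinarith [norm_nonneg a])

theorem rho_ne_zero {a : ℂ} (ha : ‖a‖ < 1) : (rho a : ℂ) ≠ 0 :=
  Complex.ofReal_ne_zero.2 (rho_pos ha).ne'

theorem rho_conj (a : ℂ) : rho (conj a) = rho a := by simp [rho]

theorem conjTranspose_theta (a : ℂ) : (theta a)ᴴ = theta (conj a) := by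
  ext i j
  fin_cases i <;> fin_cases j <;> simp [theta, rho_conj]

theorem theta_mul_theta_conj {a : ℂ} (ha : ‖a‖ ≤ 1) : theta a * theta (conj a) = 1 := by
  have hdiag : conj a * a + rho a * rho a = 1 := by rw [rho_mul_self ha]; ring
  rw [theta, theta, RCLike.conj_conj, rho_conj, Matrix.mul_fin_two, Matrix.one_fin_two]
  congr! 5 <;> first | ring1 | linear_combination hdiag

theorem conjTranspose_directSum (B : ℕ → Matrix (Fin 2) (Fin 2) ℂ) :
    (directSum B)ᴴ = directSum fun k => (B k)ᴴ := by
  ext m n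
  by_cases h : m / 2 = n / 2
  · simp [directSum, h]
  · simp [directSum, h, Ne.symm h]

theorem conjTranspose_oneDirectSum (A : Matrix ℕ ℕ ℂ) :
    (oneDirectSum A)ᴴ = oneDirectSum Aᴴ := by
  ext m n
  cases m <;> cases n <;> simp [oneDirectSum]

theorem conjTranspose_matL (α : ℕ → ℂ) : (matL α)ᴴ = matL fun n => conj (α n) := by
  simp only [matL, conjTranspose_directSum, conjTranspose_theta]

theorem conjTranspose_matM (α : ℕ → ℂ) : (matM α)ᴴ = matM fun n => conj (α n) := by
  simp only [matM, conjTranspose_oneDirectSum, conjTranspose_directSum, conjTranspose_theta]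

/-- A matrix all of whose nonzero entries lie on the main diagonal or next to it. -/
def IsTridiagonal (A : Matrix ℕ ℕ ℂ) : Prop :=
  ∀ ⦃m n : ℕ⦄, m + 1 < n ∨ n + 1 < m → A m n = 0

theorem IsTridiagonal.conjTranspose {A : Matrix ℕ ℕ ℂ} (hA : IsTridiagonal A) :
    IsTridiagonal Aᴴ := fun m n h => by
  rw [Matrix.conjTranspose_apply, hA h.symm, star_zero]

theorem isTridiagonal_directSum (B : ℕ → Matrix (Fin 2) (Fin 2) ℂ) :
    IsTridiagonal (directSum B) := fun m n h => if_neg (by omega)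

theorem IsTridiagonal.oneDirectSum {A : Matrix ℕ ℕ ℂ} (hA : IsTridiagonal A) :
    IsTridiagonal (oneDirectSum A)
  | 0, 0, h => by omega
  | 0, _ + 1, _ => rfl
  | _ + 1, 0, _ => rfl
  | _ + 1, _ + 1, h => hA (by omega)

theorem isTridiagonal_matL (α : ℕ → ℂ) : IsTridiagonal (matL α) :=
  isTridiagonal_directSum _

theorem isTridiagonal_matM (α : ℕ → ℂ) : IsTridiagonal (matM α) :=
  (isTridiagonal_directSum _).oneDirectSum

theorem matL_apply_self {α : ℕ → ℂ} {n : ℕ} (hn : Even n) : matL α n n = conj (α n) := by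
  obtain ⟨k, rfl⟩ := even_iff_exists_two_mul.1 hn
  simp [matL, directSum, theta, Fin.ofNat]

theorem matM_apply_self {α : ℕ → ℂ} {n : ℕ} (hn : Odd n) : matM α n n = conj (α n) := by
  obtain ⟨k, rfl⟩ := hn
  simp [matM, oneDirectSum, directSum, theta, Fin.ofNat]

section Combine

variable {E : Type*} [AddCommGroup E] [Module ℂ E]

/-- The family with members `∑ⱼ Aⱼₙ eⱼ`, where the columns of `A` are the coefficients. The
truncation `j ≤ n + 1` of the sum is harmless for tridiagonal `A`. -/
noncomputable def combine (A : Matrix ℕ ℕ ℂ) (e : ℕ → E) (n : ℕ) : E :=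
  ∑ j ∈ range (n + 2), A j n • e j

theorem IsTridiagonal.combine_eq_sum {A : Matrix ℕ ℕ ℂ} (hA : IsTridiagonal A) (e : ℕ → E)
    {n N : ℕ} (hN : n + 2 ≤ N) : combine A e n = ∑ j ∈ range N, A j n • e j :=
  sum_subset (range_mono hN) fun j _ hj => by
    rw [hA (Or.inr (not_lt.1 fun h => hj (mem_range.2 h))), zero_smul]

theorem combine_mem_span (A : Matrix ℕ ℕ ℂ) (e : ℕ → E) (n : ℕ) :
    combine A e n ∈ Submodule.span ℂ (Set.range e) :=
  sum_mem fun j _ => Submodule.smul_mem _ _ (Submodule.subset_span ⟨j, rfl⟩)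

theorem span_combine_le (A : Matrix ℕ ℕ ℂ) (e : ℕ → E) :
    Submodule.span ℂ (Set.range (combine A e)) ≤ Submodule.span ℂ (Set.range e) :=
  Submodule.span_le.2 (Set.range_subset_iff.2 (combine_mem_span A e))

theorem span_combine {A B : Matrix ℕ ℕ ℂ} {e : ℕ → E} (h : combine B (combine A e) = e) :
    Submodule.span ℂ (Set.range (combine A e)) = Submodule.span ℂ (Set.range e) :=
  (span_combine_le A e).antisymm <| by simpa only [h] using span_combine_le B (combine A e)

theorem combine_directSum (B : ℕ → Matrix (Fin 2) (Fin 2) ℂ) (e : ℕ → E) (k : ℕ) (r : Fin 2) :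
    combine (directSum B) e (2 * k + r) = B k 0 r • e (2 * k) + B k 1 r • e (2 * k + 1) := by
  have hblock (i : Fin 2) : directSum B (2 * k + i) (2 * k + r) = B k i r := by
    have hdiv (s : Fin 2) : (2 * k + (s : ℕ)) / 2 = k := by omega
    have hmod (s : Fin 2) : Fin.ofNat 2 (2 * k + s) = s := by ext; simp [Fin.ofNat]; omega
    simp only [directSum, hdiv, hmod, if_true]
  have hne : 2 * k ≠ 2 * k + 1 := (Nat.lt_succ_self _).ne
  rw [combine, ← sum_subset (s₁ := {2 * k, 2 * k + 1}), sum_pair hne]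
  · exact congrArg₂ (fun a b : ℂ => a • e (2 * k) + b • e (2 * k + 1)) (hblock 0) (hblock 1)
  · grind
  · intro j _ hj
    rw [directSum, if_neg (by grind), zero_smul]

theorem combine_directSum_combine (B B' : ℕ → Matrix (Fin 2) (Fin 2) ℂ) (e : ℕ → E) :
    combine (directSum B) (combine (directSum B') e) =
      combine (directSum fun k => B' k * B k) e := by
  funext n
  obtain ⟨k, r, rfl⟩ : ∃ (k : ℕ) (r : Fin 2), n = 2 * k + r :=
    ⟨n / 2, Fin.ofNat 2 n, (Nat.div_add_mod n 2).symm⟩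
  have h0 : combine (directSum B') e (2 * k) =
      B' k 0 0 • e (2 * k) + B' k 1 0 • e (2 * k + 1) := combine_directSum B' e k 0
  have h1 : combine (directSum B') e (2 * k + 1) =
      B' k 0 1 • e (2 * k) + B' k 1 1 • e (2 * k + 1) := combine_directSum B' e k 1
  simp only [combine_directSum, h0, h1, Matrix.mul_apply, Fin.sum_univ_two]
  module

theorem combine_directSum_one (e : ℕ → E) : combine (directSum fun _ => 1) e = e := by
  funext n
  obtain ⟨k, rfl | rfl⟩ := Nat.even_or_odd' n
  · simpa using combine_directSum (fun _ => 1) e k 0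
  · simpa using combine_directSum (fun _ => 1) e k 1

theorem combine_oneDirectSum_zero (A : Matrix ℕ ℕ ℂ) (e : ℕ → E) :
    combine (oneDirectSum A) e 0 = e 0 := by
  simp [combine, sum_range_succ, oneDirectSum]

theorem combine_oneDirectSum_succ (A : Matrix ℕ ℕ ℂ) (e : ℕ → E) (n : ℕ) :
    combine (oneDirectSum A) e (n + 1) = combine A (fun i => e (i + 1)) n := by
  rw [combine, sum_range_succ', oneDirectSum, zero_smul, add_zero]
  rfl

theorem combine_oneDirectSum_combine {A A' : Matrix ℕ ℕ ℂ}
    (h : ∀ e : ℕ → E, combine A (combine A' e) = e) (e : ℕ → E) :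
    combine (oneDirectSum A) (combine (oneDirectSum A') e) = e := by
  funext n
  cases n with
  | zero => rw [combine_oneDirectSum_zero, combine_oneDirectSum_zero]
  | succ n =>
    simp only [combine_oneDirectSum_succ]
    exact congrFun (h fun i => e (i + 1)) n

theorem combine_directSum_theta_conj {β : ℕ → ℂ} (hβ : ∀ n, ‖β n‖ ≤ 1) (e : ℕ → E) :
    combine (directSum fun k => theta (conj (β k))) (combine (directSum fun k => theta (β k)) e) =
      e := by
  simp only [combine_directSum_combine, theta_mul_theta_conj (hβ _), combine_directSum_one]

variable {α : ℕ → ℂ}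

theorem combine_conjTranspose_matL (hα : ∀ n, ‖α n‖ ≤ 1) (e : ℕ → E) :
    combine (matL α)ᴴ (combine (matL α) e) = e := by
  rw [conjTranspose_matL]
  exact combine_directSum_theta_conj (fun k => hα (2 * k)) e

theorem combine_conjTranspose_matM (hα : ∀ n, ‖α n‖ ≤ 1) (e : ℕ → E) :
    combine (matM α)ᴴ (combine (matM α) e) = e := by
  rw [conjTranspose_matM]
  exact combine_oneDirectSum_combine
    (combine_directSum_theta_conj fun k => hα (2 * k + 1)) e

theorem combine_matL_conjTranspose (hα : ∀ n, ‖α n‖ ≤ 1) (e : ℕ → E) :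
    combine (matL α) (combine (matL α)ᴴ e) = e := by
  simpa [conjTranspose_matL] using
    combine_conjTranspose_matL (α := fun n => conj (α n)) (by simpa using hα) e

theorem combine_matM_conjTranspose (hα : ∀ n, ‖α n‖ ≤ 1) (e : ℕ → E) :
    combine (matM α) (combine (matM α)ᴴ e) = e := by
  simpa [conjTranspose_matM] using
    combine_conjTranspose_matM (α := fun n => conj (α n)) (by simpa using hα) e

theorem combine_matL_even (α : ℕ → ℂ) (e : ℕ → E) (k : ℕ) :
    combine (matL α) e (2 * k) =
      conj (α (2 * k)) • e (2 * k) + (rho (α (2 * k)) : ℂ) • e (2 * k + 1) := by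
  simpa [matL, theta] using combine_directSum (fun k => theta (α (2 * k))) e k 0

theorem combine_matL_odd (α : ℕ → ℂ) (e : ℕ → E) (k : ℕ) :
    combine (matL α) e (2 * k + 1) =
      (rho (α (2 * k)) : ℂ) • e (2 * k) - α (2 * k) • e (2 * k + 1) := by
  simpa [matL, theta, sub_eq_add_neg] using
    combine_directSum (fun k => theta (α (2 * k))) e k 1

theorem combine_matM_zero (α : ℕ → ℂ) (e : ℕ → E) : combine (matM α) e 0 = e 0 :=
  combine_oneDirectSum_zero _ e

theorem combine_matM_odd (α : ℕ → ℂ) (e : ℕ → E) (k : ℕ) :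
    combine (matM α) e (2 * k + 1) =
      conj (α (2 * k + 1)) • e (2 * k + 1) + (rho (α (2 * k + 1)) : ℂ) • e (2 * k + 2) := by
  simpa [matM, theta, combine_oneDirectSum_succ] using
    combine_directSum (fun k => theta (α (2 * k + 1))) (fun i => e (i + 1)) k 0

theorem combine_matM_even (α : ℕ → ℂ) (e : ℕ → E) (k : ℕ) :
    combine (matM α) e (2 * k + 2) =
      (rho (α (2 * k + 1)) : ℂ) • e (2 * k + 1) - α (2 * k + 1) • e (2 * k + 2) := by
  simpa [matM, theta, combine_oneDirectSum_succ, sub_eq_add_neg] using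
    combine_directSum (fun k => theta (α (2 * k + 1))) (fun i => e (i + 1)) k 1

end Combine

section Orthonormal

variable {E : Type*} [NormedAddCommGroup E] [InnerProductSpace ℂ E] {A : Matrix ℕ ℕ ℂ}
  {e : ℕ → E}

theorem IsTridiagonal.inner_combine (hA : IsTridiagonal A) (he : Orthonormal ℂ e) (m n : ℕ) :
    inner ℂ (e m) (combine A e n) = A m n := by
  rw [hA.combine_eq_sum e (show n + 2 ≤ m + n + 2 by omega),
    he.inner_right_sum _ (mem_range.2 (by omega))]

theorem IsTridiagonal.orthonormal_combine (hA : IsTridiagonal A)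
    (h : combine A (combine Aᴴ e) = e) (he : Orthonormal ℂ e) : Orthonormal ℂ (combine A e) := by
  have hadjoint (m j : ℕ) : inner ℂ (combine A e m) (e j) = inner ℂ (e m) (combine Aᴴ e j) := by
    rw [hA.conjTranspose.inner_combine he, Matrix.conjTranspose_apply, ← hA.inner_combine he j m,
      RCLike.star_def, inner_conj_symm]
  have hinner (m n : ℕ) : inner ℂ (combine A e m) (combine A e n) = inner ℂ (e m) (e n) :=
    calc inner ℂ (combine A e m) (combine A e n)
        = inner ℂ (e m) (combine A (combine Aᴴ e) n) := by
          rw [hA.combine_eq_sum e (n := n) le_rfl, hA.combine_eq_sum (combine Aᴴ e) le_rfl]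
          simp only [inner_sum, inner_smul_right, hadjoint]
      _ = inner ℂ (e m) (e n) := by rw [h]
  simpa only [orthonormal_iff_ite, hinner] using he

end Orthonormal

/-! ### CMV pairs and operators on `ℓ²` -/

section Pair

variable {H : Type*} [NormedAddCommGroup H] [InnerProductSpace ℂ H]

/-- The families `χ` and `x` satisfy the relations `U xₙ = ∑ₘ ℒₘₙ χₘ` and `χₙ = ∑ₘ ℳₘₙ xₘ` of the
CMV and the alternate CMV basis of a unitary operator `U` with Verblunsky coefficients `α`. -/
structure IsCMVPair (U : H ≃ₗᵢ[ℂ] H) (α : ℕ → ℂ) (χ x : ℕ → H) : Prop where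
  map_eq : ∀ n, U (x n) = combine (matL α) χ n
  eq_combine : ∀ n, χ n = combine (matM α) x n

theorem matC_eq_sum (α : ℕ → ℂ) {m k N : ℕ} (hN : m + 2 ≤ N) :
    matC α m k = ∑ j ∈ range N, matL α m j * matM α j k := by
  refine sum_subset (range_mono hN) fun j _ hj => ?_
  rw [matL_eq_zero α (by simpa using hj), zero_mul]

variable {U : H ≃ₗᵢ[ℂ] H} {α : ℕ → ℂ} {χ x : ℕ → H}

namespace IsCMVPair

theorem inner_map (h : IsCMVPair U α χ x) (hχ : Orthonormal ℂ χ) (m k : ℕ) :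
    inner ℂ (χ m) (U (χ k)) = matC α m k := by
  rw [h.eq_combine k, (isTridiagonal_matM α).combine_eq_sum x (show k + 2 ≤ m + k + 2 by omega),
    map_sum, inner_sum, matC_eq_sum α (show m + 2 ≤ m + k + 2 by omega)]
  refine sum_congr rfl fun j _ => ?_
  rw [map_smul, inner_smul_right, h.map_eq, (isTridiagonal_matL α).inner_combine hχ, mul_comm]

theorem orthonormal (h : IsCMVPair U α χ x) (hα : ∀ n, ‖α n‖ ≤ 1) (hχ : Orthonormal ℂ χ) :
    Orthonormal ℂ x := by
  have hx : x = U.symm ∘ combine (matL α) χ := by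
    funext n
    rw [Function.comp_apply, ← h.map_eq, U.symm_apply_apply]
  rw [hx]
  exact ((isTridiagonal_matL α).orthonormal_combine (combine_matL_conjTranspose hα χ)
    hχ).comp_linearIsometryEquiv U.symm

theorem map_span (h : IsCMVPair U α χ x) (hα : ∀ n, ‖α n‖ ≤ 1) :
    (Submodule.span ℂ (Set.range χ)).map (U.toLinearEquiv : H →ₗ[ℂ] H) =
      Submodule.span ℂ (Set.range χ) := by
  have hx : Submodule.span ℂ (Set.range χ) = Submodule.span ℂ (Set.range x) := by
    rw [funext h.eq_combine, span_combine (combine_conjTranspose_matM hα x)]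
  calc _ = Submodule.span ℂ (Set.range fun n => U (x n)) := by
        rw [hx, Submodule.map_span, ← Set.range_comp]; rfl
    _ = Submodule.span ℂ (Set.range χ) := by
        rw [funext h.map_eq, span_combine (combine_conjTranspose_matL hα χ)]

end IsCMVPair

theorem zpow_add_apply (U : H ≃ₗᵢ[ℂ] H) (m n : ℤ) (y : H) :
    (U ^ (m + n)) y = (U ^ m) ((U ^ n) y) := by
  rw [zpow_add]
  rfl

theorem zpow_neg_apply_zpow_apply (U : H ≃ₗᵢ[ℂ] H) (k : ℤ) (y : H) :
    (U ^ (-k)) ((U ^ k) y) = y := by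
  rw [← zpow_add_apply, neg_add_cancel, zpow_zero]
  rfl

theorem zpow_mem_of_map_eq {S : Submodule ℂ H}
    (hS : S.map (U.toLinearEquiv : H →ₗ[ℂ] H) = S) {y : H} (hy : y ∈ S) (n : ℤ) :
    (U ^ n) y ∈ S := by
  have hmap : ∀ y ∈ S, U y ∈ S := fun y hy => hS ▸ Submodule.mem_map_of_mem hy
  have hinv : ∀ y ∈ S, U⁻¹ y ∈ S := fun y hy => by
    obtain ⟨z, hz, rfl⟩ := hS ▸ hy
    simpa [LinearIsometryEquiv.inv_def] using hz
  induction n with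
  | zero => simpa using hy
  | succ n ih => simpa only [add_comm _ (1 : ℤ), zpow_add_apply, zpow_one] using hmap _ ih
  | pred n ih => simpa only [sub_eq_neg_add, zpow_add_apply, zpow_neg_one] using hinv _ ih

end Pair

section Ell2

theorem inner_delta (k : ℕ) (f : ell2) : inner ℂ (delta k) f = f k := by
  simp [delta, lp.inner_single_left]

theorem exists_linearIsometryEquiv_delta {H : Type*} [NormedAddCommGroup H]
    [InnerProductSpace ℂ H] [CompleteSpace H] {e : ℕ → H} (he : Orthonormal ℂ e)
    (hspan : ⊤ ≤ (Submodule.span ℂ (Set.range e)).topologicalClosure) :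
    ∃ W : H ≃ₗᵢ[ℂ] ell2, ∀ n, W (e n) = delta n :=
  ⟨(HilbertBasis.mk he hspan).repr, fun n => by
    simpa [delta] using (HilbertBasis.mk he hspan).repr_self n⟩

theorem orthonormal_delta : Orthonormal ℂ delta := by
  rw [orthonormal_iff_ite]
  intro i j
  rw [inner_delta, delta, lp.single_apply]
  simp [Pi.single_apply]

theorem topologicalClosure_span_delta :
    (Submodule.span ℂ (Set.range delta)).topologicalClosure = ⊤ := by
  rw [Submodule.topologicalClosure_eq_top_iff, Submodule.eq_bot_iff]
  intro f hf
  ext n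
  rw [← inner_delta]
  simpa using hf (delta n) (Submodule.subset_span (Set.mem_range_self n))

theorem HasMatrix.unique {C C' : ell2 ≃ₗᵢ[ℂ] ell2} {A : Matrix ℕ ℕ ℂ} (h : HasMatrix C A)
    (h' : HasMatrix C' A) : C = C' := by
  have hdelta : Set.EqOn (C : ell2 →L[ℂ] ell2) (C' : ell2 →L[ℂ] ell2) (Set.range delta) := by
    rintro _ ⟨k, rfl⟩
    ext m
    exact (h m k).trans (h' m k).symm
  have hdense := Submodule.dense_iff_topologicalClosure_eq_top.2 topologicalClosure_span_delta
  have heq : (C : ell2 →L[ℂ] ell2) = C' := ContinuousLinearMap.ext_on hdense hdelta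
  exact LinearIsometryEquiv.ext fun f => DFunLike.congr_fun heq f

variable {α : ℕ → ℂ}

theorem IsCMVPair.hasMatrix {C : ell2 ≃ₗᵢ[ℂ] ell2} {x : ℕ → ell2}
    (h : IsCMVPair C α delta x) : HasMatrix C (matC α) := fun m k => by
  rw [← inner_delta, h.inner_map orthonormal_delta]

theorem exists_isCMVPair_delta (hα : ∀ n, ‖α n‖ ≤ 1) :
    ∃ (C : ell2 ≃ₗᵢ[ℂ] ell2) (x : ℕ → ell2), IsCMVPair C α delta x := by
  have hspan {A B : Matrix ℕ ℕ ℂ} (h : combine B (combine A delta) = delta) :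
      ⊤ ≤ (Submodule.span ℂ (Set.range (combine A delta))).topologicalClosure := by
    rw [span_combine h, topologicalClosure_span_delta]
  obtain ⟨L, hL⟩ := exists_linearIsometryEquiv_delta
    ((isTridiagonal_matL α).orthonormal_combine (combine_matL_conjTranspose hα delta)
      orthonormal_delta) (hspan (combine_conjTranspose_matL hα delta))
  obtain ⟨M, hM⟩ := exists_linearIsometryEquiv_delta
    ((isTridiagonal_matM α).conjTranspose.orthonormal_combine
      (by simpa using combine_conjTranspose_matM hα delta)
      orthonormal_delta) (hspan (combine_matM_conjTranspose hα delta))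
  refine ⟨M.trans L.symm, combine (matM α)ᴴ delta, fun n => ?_, fun n => ?_⟩
  · rw [LinearIsometryEquiv.trans_apply, hM, ← hL, L.symm_apply_apply]
  · rw [combine_matM_conjTranspose hα]

theorem HasMatrix.exists_isCMVPair {C : ell2 ≃ₗᵢ[ℂ] ell2} (h : HasMatrix C (matC α))
    (hα : ∀ n, ‖α n‖ ≤ 1) : ∃ x : ℕ → ell2, IsCMVPair C α delta x := by
  obtain ⟨C', x, hx⟩ := exists_isCMVPair_delta hα
  exact ⟨x, h.unique hx.hasMatrix ▸ hx⟩

theorem existsUnique_hasMatrix (hα : ∀ n, ‖α n‖ ≤ 1) :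
    ∃! C : ell2 ≃ₗᵢ[ℂ] ell2, HasMatrix C (matC α) := by
  obtain ⟨C, x, hx⟩ := exists_isCMVPair_delta hα
  exact ⟨C, hx.hasMatrix, fun _ h => h.unique hx.hasMatrix⟩

end Ell2

/-! ### The Szegő recursion in a model -/

section SzegoStep

variable {E F : Type*} [AddCommGroup E] [Module ℂ E] [AddCommGroup F] [Module ℂ F]

/-- One step `(φ, φ*) ↦ (ρ⁻¹(Tφ - ᾱ φ*), ρ⁻¹(φ* - α Tφ))` of the Szegő recursion with Verblunsky
coefficient `α`, where `T` plays the role of multiplication by `z`. -/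
noncomputable def szegoStep (T : E → E) (a : ℂ) (p : E × E) : E × E :=
  ((rho a : ℂ)⁻¹ • (T p.1 - conj a • p.2), (rho a : ℂ)⁻¹ • (p.2 - a • T p.1))

theorem map_szegoStep {G : Type*} [FunLike G E F] [LinearMapClass G ℂ E F] {f : G} {T : E → E}
    {T' : F → F} (hf : Function.Semiconj f T T') (a : ℂ) (p : E × E) :
    Prod.map f f (szegoStep T a p) = szegoStep T' a (Prod.map f f p) := by
  simp only [szegoStep, Prod.map, map_smul, map_sub, hf.eq]

/-- A Szegő step is the relation `(Tφ, d) = (φ*, b) Θ(a)`, as in the blocks of `ℒ` and `ℳ`, solved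
for `b` and `d`. -/
theorem szegoStep_eq_iff {a : ℂ} (ha : ‖a‖ < 1) {T : E → E} {p : E × E} {b d : E} :
    szegoStep T a p = (b, d) ↔
      T p.1 = conj a • p.2 + (rho a : ℂ) • b ∧ d = (rho a : ℂ) • p.2 - a • b := by
  have h0 := rho_ne_zero ha
  have h1 := rho_mul_self ha.le
  rw [szegoStep, Prod.mk.injEq]
  constructor
  · rintro ⟨rfl, rfl⟩
    constructor <;> match_scalars <;> field_simp
    · ring
    · linear_combination -h1
  · rintro ⟨hT, rfl⟩
    rw [hT]
    constructor <;> match_scalars <;> field_simp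
    · ring
    · linear_combination -h1

end SzegoStep

section Szego

variable {H H' : Type*} [NormedAddCommGroup H] [InnerProductSpace ℂ H]
  [NormedAddCommGroup H'] [InnerProductSpace ℂ H']

/-- The vectors `(φₙ(U) v, φₙ*(U) v)` of the model `(H, U, v)`. The coefficient of the `n`-th
step of the Szegő recursion is `⟪U φₙ, φₙ*⟫`, the one for which `φₙ₊₁ ⟂ φₙ*`. -/
noncomputable def szego (U : H ≃ₗᵢ[ℂ] H) (v : H) : ℕ → H × H
  | 0 => (v, v)
  | n + 1 => szegoStep U (inner ℂ (U (szego U v n).1) (szego U v n).2) (szego U v n)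

/-- The Verblunsky coefficients of the model `(H, U, v)`. -/
noncomputable def modelCoeff (U : H ≃ₗᵢ[ℂ] H) (v : H) (n : ℕ) : ℂ :=
  inner ℂ (U (szego U v n).1) (szego U v n).2

theorem szego_succ (U : H ≃ₗᵢ[ℂ] H) (v : H) (n : ℕ) :
    szego U v (n + 1) = szegoStep U (modelCoeff U v n) (szego U v n) := rfl

theorem szego_map {U : H ≃ₗᵢ[ℂ] H} {U' : H' ≃ₗᵢ[ℂ] H'} {W : H ≃ₗᵢ[ℂ] H'}
    (hW : Function.Semiconj W U U') (v : H) (n : ℕ) :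
    szego U' (W v) n = Prod.map W W (szego U v n) := by
  induction n with
  | zero => rfl
  | succ n ih =>
    rw [szego_succ, szego_succ, map_szegoStep hW, modelCoeff, modelCoeff, ih]
    simp only [Prod.map, ← hW.eq, LinearIsometryEquiv.inner_map_map]

theorem ModelEquiv.modelCoeff_eq {U : H ≃ₗᵢ[ℂ] H} {U' : H' ≃ₗᵢ[ℂ] H'} {v : H} {v' : H'}
    (h : ModelEquiv U v U' v') : modelCoeff U v = modelCoeff U' v' := by
  obtain ⟨W, rfl, hW⟩ := h
  have hsemi : Function.Semiconj W U U' := fun y => by rw [← hW, W.symm_apply_apply]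
  funext n
  simp only [modelCoeff, szego_map hsemi, Prod.map, ← hsemi.eq, LinearIsometryEquiv.inner_map_map]

theorem semiconj_zpow (U : H ≃ₗᵢ[ℂ] H) (k : ℤ) : Function.Semiconj (U ^ k) U U := fun y => by
  simpa only [zpow_add_apply, zpow_one] using
    congrArg (fun m : ℤ => (U ^ m) y) (add_comm k 1)

variable {U : H ≃ₗᵢ[ℂ] H} {α : ℕ → ℂ} {χ x : ℕ → H}

/-- The pair `(φₙ, φₙ*)` read off the CMV basis `χ` and the alternate CMV basis `x`: for even `n`
the bases consist of `χₙ = U^{-n/2} φₙ*` and `xₙ = U^{-n/2} φₙ`, for odd `n` of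
`χₙ = U^{-(n-1)/2} φₙ` and `xₙ = U^{-(n+1)/2} φₙ*`. -/
noncomputable def szegoPair (U : H ≃ₗᵢ[ℂ] H) (χ x : ℕ → H) (n : ℕ) : H × H :=
  if Even n then ((U ^ (n / 2 : ℤ)) (x n), (U ^ (n / 2 : ℤ)) (χ n))
  else ((U ^ (n / 2 : ℤ)) (χ n), (U ^ ((n + 1) / 2 : ℤ)) (x n))

theorem szegoPair_even (U : H ≃ₗᵢ[ℂ] H) (χ x : ℕ → H) (k : ℕ) :
    szegoPair U χ x (2 * k) = Prod.map (U ^ (k : ℤ)) (U ^ (k : ℤ)) (x (2 * k), χ (2 * k)) := by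
  have hk : ((2 * k : ℕ) : ℤ) / 2 = k := by omega
  rw [szegoPair, if_pos (even_two_mul k), hk]
  rfl

theorem szegoPair_odd (U : H ≃ₗᵢ[ℂ] H) (χ x : ℕ → H) (k : ℕ) :
    szegoPair U χ x (2 * k + 1) =
      Prod.map (U ^ (k : ℤ)) (U ^ (k : ℤ)) (χ (2 * k + 1), U (x (2 * k + 1))) := by
  have hk : ((2 * k + 1 : ℕ) : ℤ) / 2 = k := by omega
  have hk1 : (((2 * k + 1 : ℕ) : ℤ) + 1) / 2 = k + 1 := by omega
  rw [szegoPair, if_neg (Nat.not_even_two_mul_add_one k), hk, hk1, zpow_add_apply, zpow_one]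
  rfl

theorem szegoPair_even_succ (U : H ≃ₗᵢ[ℂ] H) (χ x : ℕ → H) (k : ℕ) :
    szegoPair U χ x (2 * k + 2) =
      Prod.map (U ^ (k : ℤ)) (U ^ (k : ℤ)) (U (x (2 * k + 2)), U (χ (2 * k + 2))) := by
  rw [← mul_add_one, szegoPair_even, Nat.cast_add_one]
  simp only [Prod.map, zpow_add_apply, zpow_one]

theorem szegoStep_szegoPair_even_iff (hα : ∀ n, ‖α n‖ < 1) (k : ℕ) :
    szegoStep U (α (2 * k)) (szegoPair U χ x (2 * k)) = szegoPair U χ x (2 * k + 1) ↔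
      U (x (2 * k)) = combine (matL α) χ (2 * k) ∧
        U (x (2 * k + 1)) = combine (matL α) χ (2 * k + 1) := by
  rw [szegoPair_even, szegoPair_odd, ← map_szegoStep (semiconj_zpow U k),
    ((U ^ (k : ℤ)).injective.prodMap (U ^ (k : ℤ)).injective).eq_iff, szegoStep_eq_iff (hα _),
    combine_matL_even, combine_matL_odd]

theorem szegoStep_szegoPair_odd_iff (hα : ∀ n, ‖α n‖ < 1) (k : ℕ) :
    szegoStep U (α (2 * k + 1)) (szegoPair U χ x (2 * k + 1)) = szegoPair U χ x (2 * k + 2) ↔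
      χ (2 * k + 1) = combine (matM α) x (2 * k + 1) ∧
        χ (2 * k + 2) = combine (matM α) x (2 * k + 2) := by
  rw [szegoPair_odd, szegoPair_even_succ, ← map_szegoStep (semiconj_zpow U k),
    ((U ^ (k : ℤ)).injective.prodMap (U ^ (k : ℤ)).injective).eq_iff, szegoStep_eq_iff (hα _),
    combine_matM_even, combine_matM_odd, ← U.injective.eq_iff (a := χ (2 * k + 1)),
    ← U.injective.eq_iff (a := χ (2 * k + 2))]
  simp only [map_add, map_sub, map_smul]

theorem isCMVPair_iff (hα : ∀ n, ‖α n‖ < 1) :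
    IsCMVPair U α χ x ↔ χ 0 = x 0 ∧
      ∀ n, szegoStep U (α n) (szegoPair U χ x n) = szegoPair U χ x (n + 1) := by
  constructor
  · refine fun h => ⟨(h.eq_combine 0).trans (combine_matM_zero α x), fun n => ?_⟩
    obtain ⟨k, rfl | rfl⟩ := Nat.even_or_odd' n
    · exact (szegoStep_szegoPair_even_iff hα k).2 ⟨h.map_eq _, h.map_eq _⟩
    · exact (szegoStep_szegoPair_odd_iff hα k).2 ⟨h.eq_combine _, h.eq_combine _⟩
  · rintro ⟨hzero, hstep⟩
    have heven (k : ℕ) := (szegoStep_szegoPair_even_iff hα k).1 (hstep _)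
    have hodd (k : ℕ) := (szegoStep_szegoPair_odd_iff hα k).1 (hstep _)
    refine ⟨fun n => ?_, fun n => ?_⟩
    · obtain ⟨k, rfl | rfl⟩ := Nat.even_or_odd' n
      exacts [(heven k).1, (heven k).2]
    · cases n with
      | zero => exact hzero.trans (combine_matM_zero α x).symm
      | succ n =>
        obtain ⟨k, rfl | rfl⟩ := Nat.even_or_odd' n
        exacts [(hodd k).1, (hodd k).2]

theorem IsCMVPair.inner_szegoPair (h : IsCMVPair U α χ x) (hα : ∀ n, ‖α n‖ ≤ 1)
    (hχ : Orthonormal ℂ χ) (n : ℕ) :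
    inner ℂ (U (szegoPair U χ x n).1) (szegoPair U χ x n).2 = α n := by
  obtain ⟨k, rfl | rfl⟩ := Nat.even_or_odd' n
  · rw [szegoPair_even, Prod.map_apply, ← (semiconj_zpow U k).eq,
      LinearIsometryEquiv.inner_map_map, h.map_eq, ← inner_conj_symm,
      (isTridiagonal_matL α).inner_combine hχ, matL_apply_self (even_two_mul k), RCLike.conj_conj]
  · rw [szegoPair_odd, Prod.map_apply, ← (semiconj_zpow U k).eq,
      LinearIsometryEquiv.inner_map_map, LinearIsometryEquiv.inner_map_map, h.eq_combine,
      ← inner_conj_symm, (isTridiagonal_matM α).inner_combine (h.orthonormal hα hχ),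
      matM_apply_self (odd_two_mul_add_one k), RCLike.conj_conj]

theorem IsCMVPair.szego_eq (h : IsCMVPair U α χ x) (hα : ∀ n, ‖α n‖ < 1)
    (hχ : Orthonormal ℂ χ) (n : ℕ) : szego U (χ 0) n = szegoPair U χ x n := by
  obtain ⟨hzero, hstep⟩ := (isCMVPair_iff hα).1 h
  induction n with
  | zero => simp [szego, szegoPair, hzero]
  | succ n ih =>
    rw [szego_succ, modelCoeff, ih, h.inner_szegoPair (fun n => (hα n).le) hχ, hstep]

theorem IsCMVPair.modelCoeff_eq (h : IsCMVPair U α χ x) (hα : ∀ n, ‖α n‖ < 1)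
    (hχ : Orthonormal ℂ χ) : modelCoeff U (χ 0) = α := by
  funext n
  rw [modelCoeff, h.szego_eq hα hχ, h.inner_szegoPair (fun n => (hα n).le) hχ]

/-- The CMV basis of a model. -/
noncomputable def cmvBasis (U : H ≃ₗᵢ[ℂ] H) (v : H) (n : ℕ) : H :=
  (U ^ (-(n / 2) : ℤ)) (if Even n then (szego U v n).2 else (szego U v n).1)

/-- The alternate CMV basis of a model. -/
noncomputable def altBasis (U : H ≃ₗᵢ[ℂ] H) (v : H) (n : ℕ) : H :=
  (U ^ (-((n + 1) / 2) : ℤ)) (if Even n then (szego U v n).1 else (szego U v n).2)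

theorem szegoPair_cmvBasis (U : H ≃ₗᵢ[ℂ] H) (v : H) (n : ℕ) :
    szegoPair U (cmvBasis U v) (altBasis U v) n = szego U v n := by
  have hcancel (k : ℤ) (y : H) : (U ^ k) ((U ^ (-k)) y) = y := by
    simpa only [neg_neg] using zpow_neg_apply_zpow_apply U (-k) y
  by_cases hn : Even n
  · have hhalf : ((n : ℤ) + 1) / 2 = n / 2 := by grind
    simp only [szegoPair, cmvBasis, altBasis, if_pos hn, hhalf, hcancel]
  · simp only [szegoPair, cmvBasis, altBasis, if_neg hn, hcancel]

theorem isCMVPair_cmvBasis {v : H} (h : ∀ n, ‖modelCoeff U v n‖ < 1) :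
    IsCMVPair U (modelCoeff U v) (cmvBasis U v) (altBasis U v) := by
  refine (isCMVPair_iff h).2 ⟨by simp [cmvBasis, altBasis, szego], fun n => ?_⟩
  rw [szegoPair_cmvBasis, szegoPair_cmvBasis, szego_succ]

theorem IsCMVPair.cmvBasis_eq (h : IsCMVPair U α χ x) (hα : ∀ n, ‖α n‖ < 1)
    (hχ : Orthonormal ℂ χ) : cmvBasis U (χ 0) = χ := by
  funext n
  by_cases hn : Even n <;>
    simp only [cmvBasis, h.szego_eq hα hχ, szegoPair, hn, if_true, if_false,
      zpow_neg_apply_zpow_apply]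

end Szego

/-! ### Szegő polynomials -/

section Polynomial

open Polynomial

theorem coeff_szegoDual (n : ℕ) (P : ℂ[X]) (j : ℕ) :
    (szegoDual n P).coeff j = if j ≤ n then conj (P.coeff (n - j)) else 0 := by
  simp [szegoDual, coeff_monomial]

theorem szegoDual_sub (n : ℕ) (P Q : ℂ[X]) :
    szegoDual n (P - Q) = szegoDual n P - szegoDual n Q := by
  simp [szegoDual, sum_sub_distrib]

theorem szegoDual_smul (n : ℕ) (a : ℂ) (P : ℂ[X]) :
    szegoDual n (a • P) = conj a • szegoDual n P := by
  simp [szegoDual, smul_sum, smul_monomial]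

theorem szegoDual_szegoDual {n : ℕ} {P : ℂ[X]} (hP : P.natDegree ≤ n) :
    szegoDual n (szegoDual n P) = P := by
  ext j
  rw [coeff_szegoDual, coeff_szegoDual]
  split_ifs with hj
  · rw [RCLike.conj_conj, Nat.sub_sub_self hj]
  · omega
  · exact (coeff_eq_zero_of_natDegree_lt (by omega)).symm

theorem szegoDual_succ_X_mul (n : ℕ) (P : ℂ[X]) :
    szegoDual (n + 1) (X * P) = szegoDual n P := by
  ext j
  rw [coeff_szegoDual, coeff_szegoDual]
  rcases lt_trichotomy j (n + 1) with hj | rfl | hj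
  · rw [if_pos hj.le, if_pos (by omega), Nat.succ_sub (by omega), coeff_X_mul]
  · simp
  · rw [if_neg (by omega), if_neg (by omega)]

theorem szegoDual_succ {n : ℕ} {P : ℂ[X]} (hP : P.natDegree ≤ n) :
    szegoDual (n + 1) P = X * szegoDual n P := by
  ext j
  cases j with
  | zero => simp [coeff_szegoDual, coeff_eq_zero_of_natDegree_lt (Nat.lt_succ_of_le hP)]
  | succ j => simp [coeff_szegoDual]

/-- The Szegő polynomials `(φₙ, φₙ*)` with Verblunsky coefficients `α`. -/
noncomputable def szegoPoly (α : ℕ → ℂ) : ℕ → ℂ[X] × ℂ[X]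
  | 0 => (1, 1)
  | n + 1 => szegoStep (X * ·) (α n) (szegoPoly α n)

theorem natDegree_szegoPoly_le (α : ℕ → ℂ) (n : ℕ) :
    (szegoPoly α n).1.natDegree ≤ n ∧ (szegoPoly α n).2.natDegree ≤ n := by
  induction n with
  | zero => simp [szegoPoly]
  | succ n ih =>
    have hX : (X * (szegoPoly α n).1).natDegree ≤ n + 1 :=
      natDegree_mul_le.trans (by rw [natDegree_X, add_comm]; exact Nat.succ_le_succ ih.1)
    have hdual : (szegoPoly α n).2.natDegree ≤ n + 1 := ih.2.trans n.le_succ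
    have hstep (a b : ℂ) {P Q : ℂ[X]} (hP : P.natDegree ≤ n + 1) (hQ : Q.natDegree ≤ n + 1) :
        (a • (P - b • Q)).natDegree ≤ n + 1 :=
      (natDegree_smul_le _ _).trans
        (natDegree_sub_le_of_le hP ((natDegree_smul_le _ _).trans hQ) |>.trans_eq (max_self _))
    exact ⟨hstep _ _ hX hdual, hstep _ _ hdual hX⟩

theorem szegoDual_szegoPoly (α : ℕ → ℂ) (n : ℕ) :
    szegoDual n (szegoPoly α n).1 = (szegoPoly α n).2 := by
  induction n with
  | zero => simp [szegoDual, szegoPoly]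
  | succ n ih =>
    have hdual : szegoDual (n + 1) (szegoPoly α n).2 = X * (szegoPoly α n).1 := by
      rw [szegoDual_succ (natDegree_szegoPoly_le α n).2, ← ih,
        szegoDual_szegoDual (natDegree_szegoPoly_le α n).1]
    simp only [szegoPoly, szegoStep, szegoDual_smul, szegoDual_sub, szegoDual_succ_X_mul, ih,
      hdual, map_inv₀, Complex.conj_ofReal, RCLike.conj_conj]

/-- The leading coefficient `κₙ` of the Szegő polynomial `φₙ`. -/
noncomputable def szegoKappa (α : ℕ → ℂ) (n : ℕ) : ℝ := ∏ k ∈ range n, (rho (α k))⁻¹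

theorem szegoKappa_pos {α : ℕ → ℂ} {n : ℕ} (hα : ∀ k < n, ‖α k‖ < 1) : 0 < szegoKappa α n :=
  prod_pos fun k hk => inv_pos.2 (rho_pos (hα k (mem_range.1 hk)))

theorem coeff_szegoPoly_fst (α : ℕ → ℂ) (n : ℕ) :
    (szegoPoly α n).1.coeff n = (szegoKappa α n : ℂ) := by
  induction n with
  | zero => simp [szegoPoly, szegoKappa]
  | succ n ih =>
    have hdual : (szegoPoly α n).2.coeff (n + 1) = 0 :=
      coeff_eq_zero_of_natDegree_lt (Nat.lt_succ_of_le (natDegree_szegoPoly_le α n).2)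
    simp [szegoPoly, szegoStep, hdual, ih, szegoKappa, prod_range_succ, mul_comm]

theorem coeff_szegoPoly_snd (α : ℕ → ℂ) (n : ℕ) :
    (szegoPoly α n).2.coeff 0 = (szegoKappa α n : ℂ) := by
  rw [← szegoDual_szegoPoly, coeff_szegoDual, if_pos n.zero_le, Nat.sub_zero,
    coeff_szegoPoly_fst, Complex.conj_ofReal]

theorem natDegree_szegoPoly_fst {α : ℕ → ℂ} {n : ℕ} (hα : ∀ k < n, ‖α k‖ < 1) :
    (szegoPoly α n).1.natDegree = n := by
  refine (natDegree_szegoPoly_le α n).1.antisymm (le_natDegree_of_ne_zero ?_)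
  rw [coeff_szegoPoly_fst]
  exact Complex.ofReal_ne_zero.2 (szegoKappa_pos hα).ne'

theorem szegoPoly_recursion {α : ℕ → ℂ} {n : ℕ} (hα : ‖α n‖ < 1) :
    C (rho (α n) : ℂ) * (szegoPoly α (n + 1)).1 =
      X * (szegoPoly α n).1 - C (conj (α n)) * szegoDual n (szegoPoly α n).1 := by
  rw [szegoDual_szegoPoly, szegoPoly, szegoStep, ← smul_eq_C_mul, ← smul_eq_C_mul,
    smul_inv_smul₀ (rho_ne_zero hα)]

end Polynomial

section Orbit

open Polynomial

variable {H : Type*} [NormedAddCommGroup H] [InnerProductSpace ℂ H]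

/-- The span of the vectors `Uⁿ v` with `n ∈ s`. -/
def orbitSpan (U : H ≃ₗᵢ[ℂ] H) (v : H) (s : Set ℤ) : Submodule ℂ H :=
  Submodule.span ℂ ((fun n : ℤ => (U ^ n) v) '' s)

variable {U : H ≃ₗᵢ[ℂ] H} {v w : H} {s t : Set ℤ}

theorem zpow_mem_orbitSpan {n : ℤ} (hn : n ∈ s) : (U ^ n) v ∈ orbitSpan U v s :=
  Submodule.subset_span ⟨n, hn, rfl⟩

theorem orbitSpan_mono (h : s ⊆ t) : orbitSpan U v s ≤ orbitSpan U v t :=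
  Submodule.span_mono (Set.image_mono h)

theorem orbitSpan_le_iff {K : Submodule ℂ H} : orbitSpan U v s ≤ K ↔ ∀ n ∈ s, (U ^ n) v ∈ K := by
  rw [orbitSpan, Submodule.span_le, Set.image_subset_iff]
  rfl

theorem orbitSpan_insert (n : ℤ) :
    orbitSpan U v (insert n s) = Submodule.span ℂ {(U ^ n) v} ⊔ orbitSpan U v s := by
  rw [orbitSpan, Set.image_insert_eq, Submodule.span_insert, orbitSpan]

theorem zpow_apply_mem_orbitSpan {m : ℤ} (h : ∀ n ∈ s, m + n ∈ t) (hw : w ∈ orbitSpan U v s) :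
    (U ^ m) w ∈ orbitSpan U v t := by
  have hle : orbitSpan U v s ≤ (orbitSpan U v t).comap ((U ^ m).toLinearEquiv : H →ₗ[ℂ] H) :=
    orbitSpan_le_iff.2 fun n hn => by
      simpa [← zpow_add_apply] using zpow_mem_orbitSpan (h n hn)
  exact hle hw

theorem zpow_apply_mem_orbitSpan_orthogonal {m : ℤ} (h : ∀ n ∈ t, -m + n ∈ s)
    (hw : w ∈ (orbitSpan U v s)ᗮ) : (U ^ m) w ∈ (orbitSpan U v t)ᗮ := fun y hy => by
  rw [← LinearIsometryEquiv.inner_map_map (U ^ (-m)), zpow_neg_apply_zpow_apply]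
  exact hw _ (zpow_apply_mem_orbitSpan h hy)

/-- The linear map `P ↦ P(U) v`. -/
noncomputable def polyOrbit (U : H ≃ₗᵢ[ℂ] H) (v : H) : ℂ[X] →ₗ[ℂ] H :=
  (ContinuousLinearMap.apply ℂ H v : (H →L[ℂ] H) →ₗ[ℂ] H) ∘ₗ
    (aeval (U : H →L[ℂ] H)).toLinearMap

theorem polyOrbit_apply (U : H ≃ₗᵢ[ℂ] H) (v : H) (P : ℂ[X]) :
    polyOrbit U v P = aeval (U : H →L[ℂ] H) P v := rfl

theorem polyOrbit_one (U : H ≃ₗᵢ[ℂ] H) (v : H) : polyOrbit U v 1 = v := by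
  simp [polyOrbit_apply]

theorem polyOrbit_mul (U : H ≃ₗᵢ[ℂ] H) (v : H) (P Q : ℂ[X]) :
    polyOrbit U v (P * Q) = aeval (U : H →L[ℂ] H) P (polyOrbit U v Q) := by
  rw [polyOrbit_apply, map_mul, polyOrbit_apply]
  rfl

theorem semiconj_polyOrbit (U : H ≃ₗᵢ[ℂ] H) (v : H) :
    Function.Semiconj (polyOrbit U v) (X * ·) U := fun P => by
  rw [polyOrbit_mul, aeval_X]
  rfl

theorem polyOrbit_X_pow (U : H ≃ₗᵢ[ℂ] H) (v : H) (n : ℕ) :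
    polyOrbit U v (X ^ n) = (U ^ (n : ℤ)) v := by
  induction n with
  | zero => simpa using polyOrbit_one U v
  | succ n ih =>
    rw [pow_succ', (semiconj_polyOrbit U v).eq, ih, Nat.cast_add_one, add_comm, zpow_add_apply,
      zpow_one]

theorem polyOrbit_sub_mem_orbitSpan {P : ℂ[X]} {k : ℕ}
    (h : ∀ i ≠ k, P.coeff i ≠ 0 → (i : ℤ) ∈ s) :
    polyOrbit U v P - P.coeff k • (U ^ (k : ℤ)) v ∈ orbitSpan U v s := by
  have hP : P - P.coeff k • X ^ k = P.erase k := by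
    rw [smul_X_eq_monomial, sub_eq_iff_eq_add']
    exact (monomial_add_erase P k).symm
  rw [← polyOrbit_X_pow, ← map_smul, ← map_sub, hP, as_sum_support (P.erase k), map_sum]
  refine sum_mem fun i hi => ?_
  rw [support_erase, mem_erase, mem_support_iff] at hi
  rw [← smul_X_eq_monomial, map_smul, polyOrbit_X_pow]
  exact Submodule.smul_mem _ _ (zpow_mem_orbitSpan (h i hi.1 hi.2))

theorem szego_eq_polyOrbit (U : H ≃ₗᵢ[ℂ] H) (v : H) (n : ℕ) :
    szego U v n =
      Prod.map (polyOrbit U v) (polyOrbit U v) (szegoPoly (modelCoeff U v) n) := by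
  induction n with
  | zero => simp [szego, szegoPoly, polyOrbit_one]
  | succ n ih => rw [szego_succ, ih, szegoPoly, map_szegoStep (semiconj_polyOrbit U v)]

end Orbit

/-! ### Orthonormality of the CMV basis -/

section Orthogonality

variable {H : Type*} [NormedAddCommGroup H] [InnerProductSpace ℂ H]

theorem inner_sub_inner_smul_self {y : H} (hy : ‖y‖ = 1) (w : H) :
    inner ℂ y (w - inner ℂ y w • y) = 0 := by
  rw [inner_sub_right, inner_smul_right, inner_self_eq_norm_sq_to_K, hy]
  simp

theorem norm_sub_inner_smul_self {y w : H} (hy : ‖y‖ = 1) (hw : ‖w‖ = 1) :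
    ‖w - inner ℂ y w • y‖ = rho (inner ℂ y w) := by
  have horth : inner ℂ (inner ℂ y w • y) (w - inner ℂ y w • y) = 0 := by
    rw [inner_smul_left, inner_sub_inner_smul_self hy, mul_zero]
  have hpyth := norm_add_sq_eq_norm_sq_add_norm_sq_of_inner_eq_zero _ _ horth
  rw [add_sub_cancel, norm_smul, hw, hy] at hpyth
  rw [rho, show 1 - ‖inner ℂ y w‖ ^ 2 = ‖w - inner ℂ y w • y‖ ^ 2 by linarith,
    Real.sqrt_sq (norm_nonneg _)]

theorem mem_orthogonal_span_singleton_sup {K : Submodule ℂ H} {x z w : H} {c : ℂ}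
    (hw : w ∈ Kᗮ) (hzw : inner ℂ z w = 0) (hz : z - c • x ∈ K) (hc : c ≠ 0) :
    w ∈ (Submodule.span ℂ {x} ⊔ K)ᗮ := by
  have hxw : conj c * inner ℂ x w = 0 := by
    simpa [inner_sub_left, inner_smul_left, hzw] using hw _ hz
  rw [← Submodule.inf_orthogonal]
  exact ⟨Submodule.mem_orthogonal_singleton_iff_inner_right.2
    ((mul_eq_zero.1 hxw).resolve_left (star_ne_zero.2 hc)), hw⟩

variable {U : H ≃ₗᵢ[ℂ] H} {v : H}

theorem inner_szego_snd_map_szego_fst (U : H ≃ₗᵢ[ℂ] H) (v : H) (n : ℕ) :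
    inner ℂ (szego U v n).2 (U (szego U v n).1) = conj (modelCoeff U v n) :=
  (inner_conj_symm _ _).symm

theorem norm_map_szego_fst_sub {n : ℕ} (hφ : ‖(szego U v n).1‖ = 1)
    (hdual : ‖(szego U v n).2‖ = 1) :
    ‖U (szego U v n).1 - conj (modelCoeff U v n) • (szego U v n).2‖ = rho (modelCoeff U v n) := by
  rw [← inner_szego_snd_map_szego_fst, norm_sub_inner_smul_self hdual (by rw [U.norm_map, hφ]),
    inner_szego_snd_map_szego_fst, rho_conj]

theorem norm_szego_snd_sub {n : ℕ} (hφ : ‖(szego U v n).1‖ = 1)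
    (hdual : ‖(szego U v n).2‖ = 1) :
    ‖(szego U v n).2 - modelCoeff U v n • U (szego U v n).1‖ = rho (modelCoeff U v n) :=
  norm_sub_inner_smul_self (by rw [U.norm_map, hφ]) hdual

theorem norm_szego (hv : ‖v‖ = 1) {n : ℕ} (h : ∀ k < n, ‖modelCoeff U v k‖ < 1) :
    ‖(szego U v n).1‖ = 1 ∧ ‖(szego U v n).2‖ = 1 := by
  induction n with
  | zero => exact ⟨hv, hv⟩
  | succ n ih =>
    obtain ⟨hφ, hdual⟩ := ih fun k hk => h k (hk.trans n.lt_succ_self)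
    have hr := rho_pos (h n n.lt_succ_self)
    rw [szego_succ, szegoStep, norm_smul, norm_smul, norm_map_szego_fst_sub hφ hdual,
      norm_szego_snd_sub hφ hdual, norm_inv, Complex.norm_of_nonneg hr.le, inv_mul_cancel₀ hr.ne']
    exact ⟨rfl, rfl⟩

theorem inner_szego_szego_succ (hv : ‖v‖ = 1) {n : ℕ} (h : ∀ k < n, ‖modelCoeff U v k‖ < 1) :
    inner ℂ (szego U v n).2 (szego U v (n + 1)).1 = 0 ∧
      inner ℂ (U (szego U v n).1) (szego U v (n + 1)).2 = 0 := by
  obtain ⟨hφ, hdual⟩ := norm_szego hv h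
  have hUφ : ‖U (szego U v n).1‖ = 1 := by rw [U.norm_map, hφ]
  rw [szego_succ, szegoStep, inner_smul_right, inner_smul_right,
    ← inner_szego_snd_map_szego_fst, inner_sub_inner_smul_self hdual, modelCoeff,
    inner_sub_inner_smul_self hUφ, mul_zero]
  exact ⟨rfl, rfl⟩

theorem szego_fst_sub_mem_orbitSpan (U : H ≃ₗᵢ[ℂ] H) (v : H) (n : ℕ) :
    (szego U v n).1 - (szegoKappa (modelCoeff U v) n : ℂ) • (U ^ (n : ℤ)) v ∈
      orbitSpan U v (Set.Ico 0 n) := by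
  rw [szego_eq_polyOrbit, ← coeff_szegoPoly_fst]
  refine polyOrbit_sub_mem_orbitSpan fun i hi hcoeff => ?_
  have hdeg := Polynomial.le_natDegree_of_ne_zero hcoeff
  have hle := (natDegree_szegoPoly_le (modelCoeff U v) n).1
  simp only [Set.mem_Ico]
  omega

theorem map_szego_fst_sub_mem_orbitSpan (U : H ≃ₗᵢ[ℂ] H) (v : H) (n : ℕ) :
    U (szego U v n).1 - (szegoKappa (modelCoeff U v) n : ℂ) • (U ^ ((n : ℤ) + 1)) v ∈
      orbitSpan U v (Set.Ioc 0 n) := by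
  have hmem := zpow_apply_mem_orbitSpan (m := 1) (t := Set.Ioc 0 (n : ℤ))
    (fun i hi => by simp only [Set.mem_Ioc, Set.mem_Ico] at *; omega)
    (szego_fst_sub_mem_orbitSpan U v n)
  rwa [map_sub, map_smul, ← zpow_add_apply, zpow_one, add_comm] at hmem

theorem szego_snd_sub_mem_orbitSpan (U : H ≃ₗᵢ[ℂ] H) (v : H) (n : ℕ) :
    (szego U v n).2 - (szegoKappa (modelCoeff U v) n : ℂ) • v ∈
      orbitSpan U v (Set.Ioc 0 n) := by
  have hmem : ∀ i ≠ 0, (szegoPoly (modelCoeff U v) n).2.coeff i ≠ 0 →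
      (i : ℤ) ∈ Set.Ioc (0 : ℤ) n := fun i hi hcoeff => by
    have hdeg := Polynomial.le_natDegree_of_ne_zero hcoeff
    have hle := (natDegree_szegoPoly_le (modelCoeff U v) n).2
    simp only [Set.mem_Ioc]
    omega
  simpa [szego_eq_polyOrbit, coeff_szegoPoly_snd] using
    polyOrbit_sub_mem_orbitSpan (U := U) (v := v) hmem

theorem szego_mem_orbitSpan (U : H ≃ₗᵢ[ℂ] H) (v : H) (n : ℕ) :
    (szego U v n).1 ∈ orbitSpan U v (Set.Icc 0 n) ∧
      (szego U v n).2 ∈ orbitSpan U v (Set.Icc 0 n) := by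
  have hn : (U ^ (n : ℤ)) v ∈ orbitSpan U v (Set.Icc 0 n) := zpow_mem_orbitSpan (by simp)
  have hzero : v ∈ orbitSpan U v (Set.Icc 0 n) :=
    zpow_mem_orbitSpan (n := 0) (by simp)
  exact ⟨(Submodule.sub_mem_iff_left _ (Submodule.smul_mem _ _ hn)).1
      (orbitSpan_mono Set.Ico_subset_Icc_self (szego_fst_sub_mem_orbitSpan U v n)),
    (Submodule.sub_mem_iff_left _ (Submodule.smul_mem _ _ hzero)).1
      (orbitSpan_mono Set.Ioc_subset_Icc_self (szego_snd_sub_mem_orbitSpan U v n))⟩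

theorem szego_mem_orbitSpan_orthogonal (hv : ‖v‖ = 1) {n : ℕ}
    (h : ∀ k < n, ‖modelCoeff U v k‖ < 1) :
    (szego U v n).1 ∈ (orbitSpan U v (Set.Ico 0 n))ᗮ ∧
      (szego U v n).2 ∈ (orbitSpan U v (Set.Ioc 0 n))ᗮ := by
  induction n with
  | zero => simp [orbitSpan]
  | succ n ih =>
    have hlt : ∀ k < n, ‖modelCoeff U v k‖ < 1 := fun k hk => h k (hk.trans n.lt_succ_self)
    obtain ⟨hφ, hdual⟩ := ih hlt
    obtain ⟨hdual_succ, hmap_succ⟩ := inner_szego_szego_succ hv hlt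
    have hκ : (szegoKappa (modelCoeff U v) n : ℂ) ≠ 0 :=
      Complex.ofReal_ne_zero.2 (szegoKappa_pos hlt).ne'
    have hUφ : U (szego U v n).1 ∈ (orbitSpan U v (Set.Ioc 0 n))ᗮ := by
      simpa only [zpow_one] using zpow_apply_mem_orbitSpan_orthogonal (m := 1)
        (t := Set.Ioc 0 (n : ℤ)) (fun i hi => by simp only [Set.mem_Ioc, Set.mem_Ico] at *; omega)
        hφ
    have hfst : (szego U v (n + 1)).1 ∈ (orbitSpan U v (Set.Ioc 0 n))ᗮ :=
      Submodule.smul_mem _ _ (Submodule.sub_mem _ hUφ (Submodule.smul_mem _ _ hdual))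
    have hsnd : (szego U v (n + 1)).2 ∈ (orbitSpan U v (Set.Ioc 0 n))ᗮ :=
      Submodule.smul_mem _ _ (Submodule.sub_mem _ hdual (Submodule.smul_mem _ _ hUφ))
    have hIco : Set.Ico (0 : ℤ) (n + 1 : ℕ) = insert 0 (Set.Ioc 0 (n : ℤ)) := by
      grind
    have hIoc : Set.Ioc (0 : ℤ) (n + 1 : ℕ) = insert ((n : ℤ) + 1) (Set.Ioc 0 (n : ℤ)) := by
      grind
    rw [hIco, hIoc, orbitSpan_insert, orbitSpan_insert]
    exact ⟨mem_orthogonal_span_singleton_sup hfst hdual_succ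
        (szego_snd_sub_mem_orbitSpan U v n) hκ,
      mem_orthogonal_span_singleton_sup hsnd hmap_succ
        (map_szego_fst_sub_mem_orbitSpan U v n) hκ⟩

/-- The exponents of the powers of `U` spanning the first `n` vectors of the CMV basis. -/
def cmvExponents (n : ℕ) : Set ℤ := Set.Ioc (-((n + 1) / 2 : ℤ)) (n / 2 : ℤ)

theorem cmvExponents_mono : Monotone cmvExponents := fun m n hmn =>
  Set.Ioc_subset_Ioc (by omega) (by omega)

theorem cmvBasis_mem_orbitSpan (U : H ≃ₗᵢ[ℂ] H) (v : H) (n : ℕ) :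
    cmvBasis U v n ∈ orbitSpan U v (cmvExponents (n + 1)) := by
  refine zpow_apply_mem_orbitSpan (s := Set.Icc 0 n) (fun i hi => ?_) ?_
  · simp only [cmvExponents, Set.mem_Ioc, Set.mem_Icc] at *
    omega
  · split_ifs
    exacts [(szego_mem_orbitSpan U v n).2, (szego_mem_orbitSpan U v n).1]

theorem cmvBasis_mem_orbitSpan_orthogonal (hv : ‖v‖ = 1) (h : ∀ k, ‖modelCoeff U v k‖ < 1)
    (n : ℕ) : cmvBasis U v n ∈ (orbitSpan U v (cmvExponents n))ᗮ := by
  obtain ⟨hφ, hdual⟩ := szego_mem_orbitSpan_orthogonal hv (n := n) fun k _ => h k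
  rw [cmvBasis]
  split_ifs with hn
  · refine zpow_apply_mem_orbitSpan_orthogonal (fun i hi => ?_) hdual
    simp only [cmvExponents, Set.mem_Ioc] at *
    grind
  · refine zpow_apply_mem_orbitSpan_orthogonal (fun i hi => ?_) hφ
    simp only [cmvExponents, Set.mem_Ioc, Set.mem_Ico] at *
    grind

theorem orthonormal_cmvBasis (hv : ‖v‖ = 1) (h : ∀ k, ‖modelCoeff U v k‖ < 1) :
    Orthonormal ℂ (cmvBasis U v) := by
  have hlt {m n : ℕ} (hmn : m < n) : inner ℂ (cmvBasis U v m) (cmvBasis U v n) = 0 :=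
    cmvBasis_mem_orbitSpan_orthogonal hv h n _
      (orbitSpan_mono (cmvExponents_mono hmn) (cmvBasis_mem_orbitSpan U v m))
  refine ⟨fun n => ?_, fun m n hmn => hmn.lt_or_gt.elim hlt fun hnm =>
    inner_eq_zero_symm.1 (hlt hnm)⟩
  obtain ⟨hφ, hdual⟩ := norm_szego hv (n := n) fun k _ => h k
  rw [cmvBasis, LinearIsometryEquiv.norm_map]
  split_ifs
  exacts [hdual, hφ]

end Orthogonality

/-! ### Proper models -/

section ProperModel

open Polynomial

variable {H : Type*} [NormedAddCommGroup H] [InnerProductSpace ℂ H] {U : H ≃ₗᵢ[ℂ] H} {v : H}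

theorem finiteDimensional_range_polyOrbit {Q : ℂ[X]} (hQ : Q ≠ 0) (hzero : polyOrbit U v Q = 0) :
    FiniteDimensional ℂ (LinearMap.range (polyOrbit U v)) := by
  have hfg : ((degreeLT ℂ Q.natDegree).map (polyOrbit U v)).FG := by
    rw [degreeLT_eq_span_X_pow]
    exact (Submodule.fg_span (finite_toSet _)).map _
  have hle : LinearMap.range (polyOrbit U v) ≤ (degreeLT ℂ Q.natDegree).map (polyOrbit U v) := by
    rintro _ ⟨P, rfl⟩
    refine ⟨P % Q, mem_degreeLT.2 ?_, ?_⟩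
    · rw [← degree_eq_natDegree hQ]
      exact degree_mod_lt P hQ
    · conv_rhs => rw [← EuclideanDomain.div_add_mod P Q]
      rw [map_add, mul_comm, polyOrbit_mul, hzero, map_zero, zero_add]
  have := Module.Finite.iff_fg.2 hfg
  exact Submodule.finiteDimensional_of_le hle

theorem IsCyclicUnitaryModel.eq_top_of_finiteDimensional (h : IsCyclicUnitaryModel U v)
    {S : Submodule ℂ H} [FiniteDimensional ℂ S] (hS : ∀ y ∈ S, U y ∈ S) (hv : v ∈ S) :
    S = ⊤ := by
  have hmap : S.map (U.toLinearEquiv : H →ₗ[ℂ] H) = S :=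
    Submodule.eq_of_le_of_finrank_eq (Submodule.map_le_iff_le_comap.2 hS)
      (LinearEquiv.finrank_map_eq U.toLinearEquiv S)
  have horbit : Submodule.span ℂ (Set.range fun n : ℤ => (U ^ n) v) ≤ S :=
    Submodule.span_le.2 (Set.range_subset_iff.2 (zpow_mem_of_map_eq hmap hv))
  have hclosure := Submodule.dense_iff_topologicalClosure_eq_top.1 (h.cyclic.mono horbit)
  rwa [S.closed_of_finiteDimensional.submodule_topologicalClosure_eq] at hclosure

theorem IsProperCyclicUnitaryModel.polyOrbit_injective (h : IsProperCyclicUnitaryModel U v) :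
    Function.Injective (polyOrbit U v) := by
  rw [injective_iff_map_eq_zero]
  intro Q hzero
  by_contra hQ
  have := finiteDimensional_range_polyOrbit hQ hzero
  have htop : LinearMap.range (polyOrbit U v) = ⊤ := by
    refine h.eq_top_of_finiteDimensional ?_ ⟨1, polyOrbit_one U v⟩
    rintro _ ⟨P, rfl⟩
    exact ⟨X * P, (semiconj_polyOrbit U v).eq P⟩
  exact h.infinite_dimensional (Module.finite_def.2 (htop ▸ Module.Finite.iff_fg.1 this))

theorem IsProperCyclicUnitaryModel.norm_modelCoeff_lt_one (h : IsProperCyclicUnitaryModel U v)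
    (n : ℕ) : ‖modelCoeff U v n‖ < 1 := by
  induction n using Nat.strong_induction_on with
  | _ n ih =>
    by_contra! hge
    have hrho : rho (modelCoeff U v n) = 0 :=
      Real.sqrt_eq_zero_of_nonpos (sub_nonpos.2 (one_le_pow₀ hge))
    obtain ⟨hφ, hdual⟩ := norm_szego h.norm_eq_one ih
    have hvanish := norm_map_szego_fst_sub hφ hdual
    rw [hrho, norm_eq_zero, sub_eq_zero, szego_eq_polyOrbit, Prod.map_fst, Prod.map_snd,
      ← (semiconj_polyOrbit U v).eq, ← map_smul] at hvanish
    have hcoeff := congrArg (coeff · (n + 1)) (h.polyOrbit_injective hvanish)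
    have hdeg : (szegoPoly (modelCoeff U v) n).2.coeff (n + 1) = 0 :=
      coeff_eq_zero_of_natDegree_lt (Nat.lt_succ_of_le (natDegree_szegoPoly_le _ n).2)
    simp only [coeff_X_mul, coeff_smul, hdeg, smul_zero, coeff_szegoPoly_fst] at hcoeff
    exact (szegoKappa_pos ih).ne' (Complex.ofReal_eq_zero.1 hcoeff)

theorem HasMatrix.modelCoeff_eq {C : ell2 ≃ₗᵢ[ℂ] ell2} {α : ℕ → ℂ} (h : HasMatrix C (matC α))
    (hα : ∀ n, ‖α n‖ < 1) : modelCoeff C (delta 0) = α := by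
  obtain ⟨x, hx⟩ := h.exists_isCMVPair fun n => (hα n).le
  exact hx.modelCoeff_eq hα orthonormal_delta

theorem IsProperCMV.eq_of_modelCoeff_eq {C C' : ell2 ≃ₗᵢ[ℂ] ell2} (hC : IsProperCMV C)
    (hC' : IsProperCMV C') (h : modelCoeff C (delta 0) = modelCoeff C' (delta 0)) : C = C' := by
  obtain ⟨α, hα, hmat⟩ := hC
  obtain ⟨α', hα', hmat'⟩ := hC'
  rw [hmat.modelCoeff_eq hα, hmat'.modelCoeff_eq hα'] at h
  subst h
  exact hmat.unique hmat'

theorem IsProperCMV.isProperCyclicUnitaryModel {C : ell2 ≃ₗᵢ[ℂ] ell2} (hC : IsProperCMV C) :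
    IsProperCyclicUnitaryModel C (delta 0) := by
  obtain ⟨α, hα, hmat⟩ := hC
  obtain ⟨x, hx⟩ := hmat.exists_isCMVPair fun n => (hα n).le
  have horbit (n : ℕ) :
      delta n ∈ Submodule.span ℂ (Set.range fun k : ℤ => (C ^ k) (delta 0)) := by
    rw [← Set.image_univ, ← congrFun (hx.cmvBasis_eq hα orthonormal_delta) n]
    exact orbitSpan_mono (Set.subset_univ _) (cmvBasis_mem_orbitSpan C (delta 0) n)
  refine ⟨⟨orthonormal_delta.1 0, ?_⟩, fun hfin => ?_⟩
  · exact (Submodule.dense_iff_topologicalClosure_eq_top.2 topologicalClosure_span_delta).mono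
      (Submodule.span_le.2 (Set.range_subset_iff.2 horbit))
  · exact not_finite_iff_infinite.2 inferInstance orthonormal_delta.linearIndependent.finite

variable [CompleteSpace H]

theorem IsProperCyclicUnitaryModel.exists_isProperCMV (h : IsProperCyclicUnitaryModel U v) :
    ∃ C : ell2 ≃ₗᵢ[ℂ] ell2, IsProperCMV C ∧ ModelEquiv U v C (delta 0) := by
  have hα := h.norm_modelCoeff_lt_one
  have hχ := orthonormal_cmvBasis h.norm_eq_one hα
  have hpair := isCMVPair_cmvBasis hα
  have hzero : cmvBasis U v 0 = v := by simp [cmvBasis, szego]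
  have horbit (n : ℤ) : (U ^ n) v ∈ Submodule.span ℂ (Set.range (cmvBasis U v)) :=
    zpow_mem_of_map_eq (hpair.map_span fun n => (hα n).le)
      (hzero ▸ Submodule.subset_span (Set.mem_range_self 0)) n
  have hdense : Dense (Submodule.span ℂ (Set.range (cmvBasis U v)) : Set H) :=
    h.cyclic.mono (Submodule.span_le.2 (Set.range_subset_iff.2 horbit))
  obtain ⟨W, hW⟩ := exists_linearIsometryEquiv_delta hχ
    (Submodule.dense_iff_topologicalClosure_eq_top.1 hdense).ge
  refine ⟨W.symm.trans (U.trans W), ⟨modelCoeff U v, hα, fun m k => ?_⟩, W,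
    by rw [← hW, hzero], fun _ => rfl⟩
  rw [← inner_delta, ← hW, ← hW, ← hpair.inner_map hχ]
  simp

theorem IsProperCyclicUnitaryModel.existsUnique_isProperCMV (h : IsProperCyclicUnitaryModel U v) :
    ∃! C : ell2 ≃ₗᵢ[ℂ] ell2, IsProperCMV C ∧ ModelEquiv U v C (delta 0) := by
  obtain ⟨C, hC, hUC⟩ := h.exists_isProperCMV
  refine ⟨C, ⟨hC, hUC⟩, fun C' ⟨hC', hUC'⟩ => hC'.eq_of_modelCoeff_eq hC ?_⟩
  rw [← hUC'.modelCoeff_eq, hUC.modelCoeff_eq]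

end ProperModel

/-! ### Spectral measures -/

section RieszMarkov

open MeasureTheory
open scoped ComplexOrder

variable {X : Type*} [TopologicalSpace X] [CompactSpace X] [T2Space X] [MeasurableSpace X]
  [BorelSpace X]

theorem exists_measure_integral_eq_real (Λ : C(X, ℝ) →ₚ[ℝ] ℝ) :
    ∃ μ : Measure X, IsFiniteMeasure μ ∧ ∀ f : C(X, ℝ), ∫ z, f z ∂μ = Λ f := by
  let Λc : CompactlySupportedContinuousMap X ℝ →ₚ[ℝ] ℝ :=
    .mk₀ (Λ.toLinearMap ∘ₗ
      { toFun := fun f => f.toContinuousMap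
        map_add' := fun _ _ => rfl
        map_smul' := fun _ _ => rfl })
      fun f hf => Λ.map_nonneg hf
  exact ⟨RealRMK.rieszMeasure Λc, inferInstance, fun f =>
    RealRMK.integral_rieszMeasure Λc ⟨f, HasCompactSupport.of_compactSpace _⟩⟩

theorem exists_measure_integral_eq (Λ : C(X, ℂ) →ₚ[ℂ] ℂ) :
    ∃ μ : Measure X, IsFiniteMeasure μ ∧ ∀ f : C(X, ℂ), ∫ z, f z ∂μ = Λ f := by
  let ι : C(X, ℝ) →ₗ[ℝ] C(X, ℂ) := (Complex.ofRealCLM.compLeftContinuous ℝ X).toLinearMap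
  have hreal (f : C(X, ℝ)) : ((Λ (ι f)).re : ℂ) = Λ (ι f) := by
    have hself : IsSelfAdjoint (ι f) := ContinuousMap.isSelfAdjoint_realToRCLike ℂ
    exact Complex.conj_eq_iff_re.1 (hself.map Λ)
  obtain ⟨μ, hμ, hint⟩ := exists_measure_integral_eq_real
    (.mk₀ (Complex.reLm ∘ₗ Λ.toLinearMap.restrictScalars ℝ ∘ₗ ι) fun f hf =>
      (Complex.nonneg_iff.1 (Λ.map_nonneg (ContinuousMap.realToRCLike_monotone X ℂ hf))).1)
  refine ⟨μ, hμ, fun f => ?_⟩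
  have hf : Integrable f μ :=
    f.continuous.integrable_of_hasCompactSupport (HasCompactSupport.of_compactSpace _)
  let fre : C(X, ℝ) := ⟨fun z => (f z).re, by fun_prop⟩
  let fim : C(X, ℝ) := ⟨fun z => (f z).im, by fun_prop⟩
  have hdecomp : f = ι fre + Complex.I • ι fim := by
    ext z
    simp [ι, fre, fim, mul_comm Complex.I, Complex.re_add_im]
  calc ∫ z, f z ∂μ = ((∫ z, fre z ∂μ : ℝ) : ℂ) + ((∫ z, fim z ∂μ : ℝ) : ℂ) * Complex.I :=
        (integral_re_add_im hf).symm
    _ = Λ (ι fre) + Λ (ι fim) * Complex.I := by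
        rw [hint, hint, ← hreal fre, ← hreal fim]
        rfl
    _ = Λ f := by
        rw [mul_comm, ← smul_eq_mul, ← map_smul, ← map_add, ← hdecomp]

end RieszMarkov

section SpectralMeasure

open MeasureTheory Polynomial
open scoped ComplexOrder

/-- `μ` is the spectral measure of `v` for `U`, tested on polynomials only: `P ↦ P(U) v` preserves
the `L²(μ)` inner product. -/
def IsSpectralMeasure {H : Type*} [NormedAddCommGroup H] [InnerProductSpace ℂ H]
    (μ : Measure Circle) (U : H ≃ₗᵢ[ℂ] H) (v : H) : Prop :=
  ∀ P Q : ℂ[X], ∫ z : Circle, conj (P.eval (z : ℂ)) * Q.eval (z : ℂ) ∂μ =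
    inner ℂ (polyOrbit U v P) (polyOrbit U v Q)

variable {H : Type*} [NormedAddCommGroup H] [InnerProductSpace ℂ H] [CompleteSpace H]
  {U : H ≃ₗᵢ[ℂ] H} {v : H}

/-- The inclusion of the unit circle into the plane. -/
def circleCoe : C(Circle, ℂ) := ⟨fun z => (z : ℂ), continuous_subtype_val⟩

theorem exists_starAlgHom_circle (U : H ≃ₗᵢ[ℂ] H) :
    ∃ Φ : C(Circle, ℂ) →⋆ₐ[ℂ] (H →L[ℂ] H), Φ circleCoe = (U : H →L[ℂ] H) := by
  have hU : (U : H →L[ℂ] H) ∈ unitary (H →L[ℂ] H) := (Unitary.linearIsometryEquiv.symm U).2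
  have hnormal : IsStarNormal (U : H →L[ℂ] H) := isStarNormal_of_mem_unitary hU
  let ι : C(spectrum ℂ (U : H →L[ℂ] H), Circle) :=
    ⟨fun z => ⟨z, spectrum.subset_circle_of_unitary hU z.2⟩, by fun_prop⟩
  exact ⟨(cfcHom hnormal).comp (ContinuousMap.compStarAlgHom' ℂ ℂ ι), cfcHom_id hnormal⟩

/-- The positive functional `f ↦ ⟪v, f(U) v⟫` of the spectral theorem. -/
noncomputable def vectorFunctional (Φ : C(Circle, ℂ) →⋆ₐ[ℂ] (H →L[ℂ] H)) (v : H) :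
    C(Circle, ℂ) →ₚ[ℂ] ℂ :=
  .mk₀ (innerₛₗ ℂ v ∘ₗ (ContinuousLinearMap.apply ℂ H v : (H →L[ℂ] H) →ₗ[ℂ] H) ∘ₗ
      (Φ : C(Circle, ℂ) →ₗ[ℂ] (H →L[ℂ] H)))
    fun _ hf => ((ContinuousLinearMap.nonneg_iff_isPositive _).1
      (map_nonneg Φ hf)).inner_nonneg_right v

theorem vectorFunctional_star_mul (Φ : C(Circle, ℂ) →⋆ₐ[ℂ] (H →L[ℂ] H)) (v : H)
    (f g : C(Circle, ℂ)) : vectorFunctional Φ v (star f * g) = inner ℂ (Φ f v) (Φ g v) := by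
  change inner ℂ v (Φ (star f * g) v) = _
  have hadjoint : Φ (star f * g) v = ContinuousLinearMap.adjoint (Φ f) (Φ g v) := by
    rw [map_mul, map_star]
    rfl
  rw [hadjoint, ContinuousLinearMap.adjoint_inner_right]

theorem exists_isSpectralMeasure (U : H ≃ₗᵢ[ℂ] H) (v : H) :
    ∃ μ : Measure Circle, IsSpectralMeasure μ U v := by
  obtain ⟨Φ, hΦ⟩ := exists_starAlgHom_circle U
  have hpoly (P : ℂ[X]) : Φ (aeval circleCoe P) v = polyOrbit U v P := by
    rw [polyOrbit_apply, ← hΦ, aeval_algHom_apply]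
  obtain ⟨μ, -, hint⟩ := exists_measure_integral_eq (vectorFunctional Φ v)
  refine ⟨μ, fun P Q => ?_⟩
  rw [← hpoly, ← hpoly, ← vectorFunctional_star_mul, ← hint]
  simp only [ContinuousMap.mul_apply, ContinuousMap.star_apply, aeval_continuousMap_apply]
  rfl

end SpectralMeasure

section Verblunsky

open MeasureTheory Polynomial

variable {H : Type*} [NormedAddCommGroup H] [InnerProductSpace ℂ H]
  {U : H ≃ₗᵢ[ℂ] H} {v : H} {μ : Measure Circle}

theorem IsSpectralMeasure.isProbabilityMeasure (hμ : IsSpectralMeasure μ U v) (hv : ‖v‖ = 1) :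
    IsProbabilityMeasure μ := by
  have htotal : (μ.real Set.univ : ℂ) = 1 := by
    simpa [polyOrbit_one, inner_self_eq_norm_sq_to_K, hv] using hμ 1 1
  exact ⟨ENNReal.toReal_eq_one_iff _ |>.1 (Complex.ofReal_eq_one.1 htotal)⟩

theorem IsSpectralMeasure.isNontrivialMeasure (hμ : IsSpectralMeasure μ U v)
    (hinj : Function.Injective (polyOrbit U v)) :
    IsNontrivialMeasure μ := by
  intro s hs hsupp
  let Q : ℂ[X] := ∏ z ∈ hs.toFinset, (X - C (z : ℂ))
  have hQ : Q ≠ 0 := prod_ne_zero_iff.2 fun z _ => X_sub_C_ne_zero _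
  have hroot {z : Circle} (hz : z ∈ s) : Q.eval (z : ℂ) = 0 := by
    rw [eval_prod]
    exact prod_eq_zero (hs.mem_toFinset.2 hz) (by simp)
  have hnull : inner ℂ (polyOrbit U v Q) (polyOrbit U v Q) = 0 := by
    rw [← hμ]
    refine integral_eq_zero_of_ae ?_
    filter_upwards [mem_ae_iff.2 hsupp] with z hz
    simp [hroot hz]
  exact hQ ((map_eq_zero_iff _ hinj).1 (inner_self_eq_zero.1 hnull))

theorem IsSpectralMeasure.isOrthonormalPolynomials (hμ : IsSpectralMeasure μ U v) (hv : ‖v‖ = 1)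
    (h : ∀ n, ‖modelCoeff U v n‖ < 1) :
    IsOrthonormalPolynomials μ fun n => (szegoPoly (modelCoeff U v) n).1 where
  natDegree_eq n := natDegree_szegoPoly_fst fun k _ => h k
  leadingCoeff_pos n := by
    refine ⟨szegoKappa (modelCoeff U v) n, szegoKappa_pos fun k _ => h k, ?_⟩
    rw [leadingCoeff, natDegree_szegoPoly_fst fun k _ => h k, coeff_szegoPoly_fst]
  orthogonal n j hj := by
    have horth : inner ℂ ((U ^ (j : ℤ)) v) (szego U v n).1 = 0 :=
      (szego_mem_orbitSpan_orthogonal hv fun k _ => h k).1 _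
        (zpow_mem_orbitSpan ⟨by positivity, by exact_mod_cast hj⟩)
    rw [szego_eq_polyOrbit, Prod.map_fst, ← polyOrbit_X_pow, ← hμ] at horth
    simpa only [eval_pow, eval_X] using horth
  normalized n := by
    have hnorm : ‖polyOrbit U v (szegoPoly (modelCoeff U v) n).1‖ = 1 := by
      simpa [szego_eq_polyOrbit] using (norm_szego hv fun k _ => h k : _ ∧ _).1
    have hint := hμ (szegoPoly (modelCoeff U v) n).1 (szegoPoly (modelCoeff U v) n).1
    rw [inner_self_eq_norm_sq_to_K, hnorm] at hint
    simp only [Complex.conj_mul', RCLike.ofReal_one, one_pow] at hint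
    exact_mod_cast hint

theorem IsProperCyclicUnitaryModel.exists_isVerblunskyCoefficients [CompleteSpace H]
    (h : IsProperCyclicUnitaryModel U v) :
    ∃ μ : Measure Circle, IsProbabilityMeasure μ ∧ IsNontrivialMeasure μ ∧
      IsVerblunskyCoefficients μ (modelCoeff U v) := by
  obtain ⟨μ, hμ⟩ := exists_isSpectralMeasure U v
  have hlt := h.norm_modelCoeff_lt_one
  exact ⟨μ, hμ.isProbabilityMeasure h.norm_eq_one,
    hμ.isNontrivialMeasure h.polyOrbit_injective, hlt, _,
    hμ.isOrthonormalPolynomials h.norm_eq_one hlt,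
    fun n => szegoPoly_recursion (hlt n)⟩

theorem exists_isVerblunskyCoefficients {α : ℕ → ℂ} (hα : ∀ n, ‖α n‖ < 1) :
    ∃ μ : Measure Circle, IsProbabilityMeasure μ ∧ IsNontrivialMeasure μ ∧
      IsVerblunskyCoefficients μ α := by
  obtain ⟨C, hC, -⟩ := existsUnique_hasMatrix fun n => (hα n).le
  have hmodel : IsProperCyclicUnitaryModel C (delta 0) :=
    IsProperCMV.isProperCyclicUnitaryModel ⟨α, hα, hC⟩
  simpa only [hC.modelCoeff_eq hα] using hmodel.exists_isVerblunskyCoefficients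

end Verblunsky

end CMV

theorem theorem2p2 :
    -- every proper CMV matrix is the matrix of exactly one unitary operator on `ℓ²`
    (∀ α : ℕ → ℂ, (∀ n, ‖α n‖ < 1) →
      ∃! C : CMV.ell2 ≃ₗᵢ[ℂ] CMV.ell2, CMV.HasMatrix C (CMV.matC α)) ∧
    -- for which `δ₀` is cyclic, so that `(ℓ², 𝒞, δ₀)` is a proper cyclic unitary model
    (∀ C : CMV.ell2 ≃ₗᵢ[ℂ] CMV.ell2, CMV.IsProperCMV C →
      CMV.IsProperCyclicUnitaryModel C (CMV.delta 0)) ∧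
    -- every equivalence class of proper models contains exactly one proper CMV model
    (∀ (H : Type*) [NormedAddCommGroup H] [InnerProductSpace ℂ H] [CompleteSpace H]
      (U : H ≃ₗᵢ[ℂ] H) (v₀ : H), CMV.IsProperCyclicUnitaryModel U v₀ →
      ∃! C : CMV.ell2 ≃ₗᵢ[ℂ] CMV.ell2,
        CMV.IsProperCMV C ∧ CMV.ModelEquiv U v₀ C (CMV.delta 0)) ∧
    -- Verblunsky's theorem
    (∀ α : ℕ → ℂ, (∀ n, ‖α n‖ < 1) →
      ∃ μ : MeasureTheory.Measure Circle, MeasureTheory.IsProbabilityMeasure μ ∧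
        CMV.IsNontrivialMeasure μ ∧ CMV.IsVerblunskyCoefficients μ α) :=
  ⟨fun _ hα => CMV.existsUnique_hasMatrix fun n => (hα n).le,
    fun _ hC => hC.isProperCyclicUnitaryModel,
    fun _ _ _ _ _ _ h => h.existsUnique_isProperCMV,
    fun _ hα => CMV.exists_isVerblunskyCoefficients hα⟩
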